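/- Let $\Omega\subseteq\mathbb R^d$ be locally compact in the subspace topology (for example open or compact), let $\mathcal C_0(\Omega)$ be the real continuous functions on $\Omega$ vanishing at infinity, and let $\mathcal M(\Omega)=\mathcal C_0(\Omega)^*$ be the space of Radon measures with the total variation norm. Let $\mathcal B$ be a real Banach space (for example $\mathcal B=\{u\in\mathcal D'(\Omega): Lu\in\mathcal M(\Omega),\ \|u\|_K<\infty\}$ with norm $\|Lu\|_{TV}+\|u\|_K$, when this is complete), and let $L:\mathcal B\to\mathcal M(\Omega)$ be a bounded linear operator with closed range such that $\ker L$ has a closed complement $V$ in $\mathcal B$ and $\operatorname{ran}L$ has a closed complement in $\mathcal M(\Omega)$. Let $L^+=j_V(L|_V)^{-1}\Pi_{\operatorname{ran}L}:\mathcal M(\Omega)\to\mathcal B$ be the corresponding pseudoinverse, where $j_V:V\hookrightarrow\mathcal B$ is the inclusion and $\Pi_{\operatorname{ran}L}$ the projection onto $\operatorname{ran}L$ along its chosen complement. Let $a_1,\dots,a_m\in\mathcal B^*$, $(Au)_i=\langle a_i,u\rangle$ and $A^*q=\sum_i q_ia_i$, and suppose that $\rho_i:=(L^+)^*a_i$ belongs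 to $\mathcal C_0(\Omega)$, i.e. $\langle a_i,L^+\mu\rangle=\int_\Omega\rho_i\,d\mu$ for all $\mu\in\mathcal M(\Omega)$. Let $f_b:\mathbb R^m\to\mathbb R\cup\{+\infty\}$ be convex and lower semicontinuous, and suppose that the problem $$\inf_{u\in\mathcal B}\ J(u):=f_b(Au)+\|Lu\|_{TV}\qquad(1)$$ has at least one solution. Suppose that $\operatorname{ran}L=\mathcal M(\Omega)$ and that the dual problem $$\sup\{-f_b^*(q)\;:\; q\in\mathbb R^m,\ A^*q\in\operatorname{ran}L^*,\ \|(L^+)^*A^*q\|_\infty\le 1\}$$ has a solution. Suppose finally that $\Omega$ is a bounded polyhedral set on which all $\rho_i$ are piecewise linear with respect to finitely many polyhedral pieces: there are finitely many convex polytopes $P_1,\dots,P_n\subset\mathbb R^d$ (convex hulls of finite sets) which cover $\Omega$, with $P_\ell=\overline{P_\ell\cap\Omega}$, such that for all $i,\ell$ there are $\alpha_{i\ell}\in\mathbb R^d$ and $\beta_{i\ell}\in\mathbb R$ with $\rho_i(x)=\langle\alpha_{i\ell},x\rangle+\beta_{i\ell}$ for $x\in P_\ell\cap\Omega$. Let $(v_j)_{j\in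 J}$ be the finitely many vertices of $P_1,\dots,P_n$ that lie in $\Omega$. Then problem (1) has at least one solution of the form $$\hat u=\sum_{j\in J}d_j\,L^+\delta_{v_j}+u_K,\qquad d_j\in\mathbb R,\quad u_K\in\ker L .$$ -/

import Mathlib

open scoped ZeroAtInfty

noncomputable section

/-- The space of (finite, signed) Radon measures on `Ω`, defined as the dual of the space of
continuous functions vanishing at infinity. Its norm, the dual norm, is the total variation
norm. -/
def RadonMeasures (Ω : Type*) [TopologicalSpace Ω] : Type _ :=
  StrongDual ℝ C₀(Ω, ℝ)

namespace RadonMeasures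

variable {Ω : Type*} [TopologicalSpace Ω]

instance : NormedAddCommGroup (RadonMeasures Ω) :=
  inferInstanceAs (NormedAddCommGroup (C₀(Ω, ℝ) →L[ℝ] ℝ))

instance : NormedSpace ℝ (RadonMeasures Ω) :=
  inferInstanceAs (NormedSpace ℝ (C₀(Ω, ℝ) →L[ℝ] ℝ))

instance : CompleteSpace (RadonMeasures Ω) :=
  inferInstanceAs (CompleteSpace (C₀(Ω, ℝ) →L[ℝ] ℝ))

/-- The functional on `C₀(Ω)` that the measure `μ` is. -/
def toDual (μ : RadonMeasures Ω) : StrongDual ℝ C₀(Ω, ℝ) := μ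

/-- The integral `∫ φ dμ`. -/
def integral (μ : RadonMeasures Ω) (φ : C₀(Ω, ℝ)) : ℝ := μ.toDual φ

/-- The Dirac mass at `x`, i.e. the functional `φ ↦ φ x`. -/
def dirac (x : Ω) : RadonMeasures Ω :=
  LinearMap.mkContinuous (E := C₀(Ω, ℝ)) (F := ℝ)
    { toFun := fun φ : C₀(Ω, ℝ) => φ x
      map_add' := fun _ _ => rfl
      map_smul' := fun _ _ => rfl } 1
    (fun φ => by
      rw [one_mul, ← ZeroAtInftyContinuousMap.norm_toBCF_eq_norm]
      exact φ.toBCF.norm_coe_le_norm x)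

end RadonMeasures

section Pseudoinverse

/-- A bounded operator `L` together with the complements from which its pseudoinverse is built:
`V` is a closed complement of the kernel, the range is closed, and `W` is a closed complement of
the range. -/
structure PseudoinverseData {X Y : Type*} [NormedAddCommGroup X] [NormedSpace ℝ X]
    [NormedAddCommGroup Y] [NormedSpace ℝ Y] (L : X →L[ℝ] Y) where
  V : Submodule ℝ X
  isClosed_V : IsClosed (V : Set X)
  isCompl_V : IsCompl L.ker V
  isClosed_range : IsClosed (L.range : Set Y)
  W : Submodule ℝ Y
  isClosed_W : IsClosed (W : Set Y)
  isCompl_W : IsCompl L.range W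

variable {X Y : Type*} [NormedAddCommGroup X] [NormedSpace ℝ X]
  [NormedAddCommGroup Y] [NormedSpace ℝ Y] {L : X →L[ℝ] Y}

/-- The restriction of `L` to `V`, as a map onto the range of `L`. -/
def PseudoinverseData.restrict (S : PseudoinverseData L) : S.V →L[ℝ] L.range :=
  (L.comp S.V.subtypeL).codRestrict L.range (fun v => ⟨v, rfl⟩)

theorem PseudoinverseData.restrict_ker (S : PseudoinverseData L) :
    S.restrict.ker = ⊥ := by
  rw [LinearMap.ker_eq_bot']
  intro v hv
  have h1 : (v : X) ∈ L.ker := congrArg Subtype.val hv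
  exact Subtype.ext (Submodule.disjoint_def.1 S.isCompl_V.disjoint _ h1 v.2)

theorem PseudoinverseData.restrict_range (S : PseudoinverseData L) :
    S.restrict.range = ⊤ := by
  rw [LinearMap.range_eq_top]
  rintro ⟨y, x, rfl⟩
  have hx : x ∈ L.ker ⊔ S.V := by
    rw [S.isCompl_V.sup_eq_top]
    trivial
  obtain ⟨k, hk, v, hv, rfl⟩ := Submodule.mem_sup.1 hx
  have hk' : L k = 0 := hk
  refine ⟨⟨v, hv⟩, Subtype.ext ?_⟩
  change L v = L (k + v)
  rw [map_add, hk', zero_add]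

variable [CompleteSpace X] [CompleteSpace Y]

/-- The restriction of `L` to `V` is an isomorphism of Banach spaces onto the range of `L`. -/
def PseudoinverseData.restrictEquiv (S : PseudoinverseData L) : S.V ≃L[ℝ] L.range :=
  haveI : CompleteSpace S.V := S.isClosed_V.completeSpace_coe
  haveI : CompleteSpace L.range := S.isClosed_range.completeSpace_coe
  ContinuousLinearEquiv.ofBijective S.restrict S.restrict_ker S.restrict_range

/-- The projection onto the range of `L` along `W`. -/
def PseudoinverseData.rangeProj (S : PseudoinverseData L) : Y →L[ℝ] L.range :=
  L.range.projectionOntoL S.W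
    (Submodule.IsCompl.isTopCompl_of_isClosed S.isCompl_W S.isClosed_range S.isClosed_W)

/-- The pseudoinverse `L⁺ = j_V ∘ (L|_V)⁻¹ ∘ Π_{ran L}`. -/
def PseudoinverseData.pinv (S : PseudoinverseData L) : Y →L[ℝ] X :=
  S.V.subtypeL.comp
    ((S.restrictEquiv.symm : L.range →L[ℝ] S.V).comp S.rangeProj)

end Pseudoinverse

section Problem

variable {B M : Type*} [NormedAddCommGroup B] [NormedSpace ℝ B]
  [NormedAddCommGroup M] [NormedSpace ℝ M] {m : ℕ}

/-- The measurement operator `(A u)_i = ⟨a_i, u⟩`. -/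
def measurement (a : Fin m → StrongDual ℝ B) : B →L[ℝ] (Fin m → ℝ) :=
  ContinuousLinearMap.pi a

/-- The adjoint of the measurement operator, `A^* q = ∑ q_i a_i`. -/
def measurementAdjoint (a : Fin m → StrongDual ℝ B) (q : Fin m → ℝ) : StrongDual ℝ B :=
  ∑ i, q i • a i

/-- The primal objective `J(u) = f(A u) + ‖L u‖`; the norm is the
total variation norm when `L` takes values in the Radon measures. -/
def primalObjective (f : (Fin m → ℝ) → EReal) (a : Fin m → StrongDual ℝ B) (L : B →L[ℝ] M)
    (u : B) : EReal :=
  f (measurement a u) + ((‖L u‖ : ℝ) : EReal)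

/-- `u` is a solution of the primal problem `inf_u J(u)`. -/
def IsPrimalSolution (f : (Fin m → ℝ) → EReal) (a : Fin m → StrongDual ℝ B) (L : B →L[ℝ] M)
    (u : B) : Prop :=
  IsMinOn (primalObjective f a L) Set.univ u

/-- Convexity of an extended-real-valued function: its epigraph is convex. -/
def IsConvexFun (f : (Fin m → ℝ) → EReal) : Prop :=
  Convex ℝ {p : (Fin m → ℝ) × ℝ | f p.1 ≤ (p.2 : EReal)}

/-- The Fenchel conjugate `f^*(q) = sup_x ⟨q, x⟩ - f(x)`. -/
def fenchelConjugate (f : (Fin m → ℝ) → EReal) (q : Fin m → ℝ) : EReal :=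
  ⨆ x : Fin m → ℝ, ((∑ i, q i * x i : ℝ) : EReal) - f x

/-- The constraint set of the dual problem: `A^* q ∈ ran L^*` and `‖(L⁺)^* A^* q‖ ≤ 1`. Here
`L^* φ = φ ∘ L` and `(L⁺)^* b = b ∘ L⁺`. -/
def dualFeasible (a : Fin m → StrongDual ℝ B) (L : B →L[ℝ] M) (Lp : M →L[ℝ] B) :
    Set (Fin m → ℝ) :=
  {q | (∃ φ : StrongDual ℝ M, φ.comp L = measurementAdjoint a q) ∧
    ‖(measurementAdjoint a q).comp Lp‖ ≤ 1}

/-- `q` is a solution of the dual problem `sup - f^*(q)` over the constraint set. -/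
def IsDualSolution (f : (Fin m → ℝ) → EReal) (a : Fin m → StrongDual ℝ B) (L : B →L[ℝ] M)
    (Lp : M →L[ℝ] B) (q : Fin m → ℝ) : Prop :=
  q ∈ dualFeasible a L Lp ∧ IsMaxOn (fun r => -fenchelConjugate f r) (dualFeasible a L Lp) q

end Problem

section Polyhedral

variable {d : ℕ} {ι : Type*}

/-- A (bounded, convex) polytope: the convex hull of a finite set. -/
def IsPolytope (P : Set (EuclideanSpace ℝ (Fin d))) : Prop :=
  ∃ T : Set (EuclideanSpace ℝ (Fin d)), T.Finite ∧ P = convexHull ℝ T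

/-- `Ω` is cut into the polyhedral pieces `P j ∩ Ω`: the `P j` are polytopes which cover `Ω`, and
each `P j` is the closure of the piece `P j ∩ Ω`. In particular the closure of `Ω` is the
union of the `P j`. Both open and closed polyhedral sets `Ω` are covered; for compact `Ω` the
conditions say that `Ω` is the union of the `P j`. -/
structure IsPolyhedralSubdivision (Ω : Set (EuclideanSpace ℝ (Fin d)))
    (P : ι → Set (EuclideanSpace ℝ (Fin d))) : Prop where
  isPolytope : ∀ j, IsPolytope (P j)
  cover : Ω ⊆ ⋃ j, P j
  subset_closure : ∀ j, P j ⊆ closure (P j ∩ Ω)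

/-- The vertices of the pieces, as points of `Ω` (a Dirac mass on `Ω` sits at a point of `Ω`). -/
def pieceVertices (Ω : Set (EuclideanSpace ℝ (Fin d)))
    (P : ι → Set (EuclideanSpace ℝ (Fin d))) : Set Ω :=
  {v | ∃ j, (v : EuclideanSpace ℝ (Fin d)) ∈ Set.extremePoints ℝ (P j)}

/-- `ρ` is piecewise linear with respect to the pieces: on `P j ∩ Ω` it has the form
`x ↦ ⟨α, x⟩ + β`. -/
def IsPiecewiseLinear {Ω : Set (EuclideanSpace ℝ (Fin d))}
    (P : ι → Set (EuclideanSpace ℝ (Fin d))) (ρ : Ω → ℝ) : Prop :=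
  ∀ j, ∃ (α : EuclideanSpace ℝ (Fin d)) (β : ℝ), ∀ x : Ω,
    (x : EuclideanSpace ℝ (Fin d)) ∈ P j → ρ x = inner ℝ α (x : EuclideanSpace ℝ (Fin d)) + β

end Polyhedral

end

/-!
The objective depends on `u` only through `A u` and `‖L u‖`. As `L` is onto,
`L (L⁺ μ) = μ`, so every `u` is `L⁺ μ` plus an element of `ker L`, where `μ = L u`, and
`⟨aᵢ, L⁺ μ⟩ = ∫ ρᵢ dμ`. It therefore suffices to replace the measure `μ = L u` of a given solution
by a combination `ν` of Dirac masses at vertices with `∫ ρᵢ dν = ∫ ρᵢ dμ` for all `i` and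
`‖ν‖ ≤ ‖μ‖`: then `L⁺ ν + (u - L⁺ μ)` is a solution as well.

The measure `ν` comes from the Hahn–Banach theorem. Let `E` be the span of the `ρᵢ` in `C₀(Ω)`. A
function `φ ∈ E` is affine on each piece `P j ∩ Ω`, hence bounded there by the values of its affine
extension at the vertices of `P j`. At a vertex outside `Ω` this extension is `0`, because `φ`
vanishes at infinity. So the sup norm on `E` is attained on the vertices in `Ω`
(`norm_le_of_forall_pieceVertices`), that is, restriction to these finitely many points is an
isometry from `E` into `ℓ^∞`. A norm-preserving extension of `μ` from `E` to `ℓ^∞` is a vector of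
weights with `ℓ¹` norm at most `‖μ‖` (`exists_weights_of_linearIsometry`).
-/

open Filter Topology
open scoped ZeroAtInfty

/-! ### Discrete measures from the Hahn–Banach theorem -/

/-- A functional on a space that embeds isometrically in a finite-dimensional `ℓ^∞` is given by
weights on the coordinates whose `ℓ¹` norm is at most the norm of the functional. -/
theorem exists_weights_of_linearIsometry {E κ : Type*} [NormedAddCommGroup E] [NormedSpace ℝ E]
    [Fintype κ] (T : E →ₗᵢ[ℝ] (κ → ℝ)) (μ : StrongDual ℝ E) :
    ∃ c : κ → ℝ, ∑ k, |c k| ≤ ‖μ‖ ∧ ∀ φ, μ φ = ∑ k, c k * T φ k := by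
  classical
  obtain ⟨F, hF, hFnorm⟩ := exists_extension_norm_eq (LinearMap.range T.toLinearMap)
    (μ.comp (T.equivRange.symm.toContinuousLinearEquiv :
      LinearMap.range T.toLinearMap →L[ℝ] E))
  have hle : ‖F‖ ≤ ‖μ‖ := by
    rw [hFnorm]
    refine ContinuousLinearMap.opNorm_le_bound _ (norm_nonneg _) fun x => ?_
    exact (μ.le_opNorm _).trans_eq (by
      congr 1
      exact T.equivRange.symm.norm_map x)
  have hsum (y : κ → ℝ) : F y = ∑ k, F (Pi.single k 1) * y k := by
    conv_lhs => rw [pi_eq_sum_univ' y, map_sum]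
    refine Finset.sum_congr rfl fun k _ => ?_
    rw [map_smul, smul_eq_mul, mul_comm]
  refine ⟨fun k => F (Pi.single k 1), ?_, fun φ => ?_⟩
  · have h1 : ∑ k, |F (Pi.single k 1)| = F fun k => SignType.sign (F (Pi.single k 1)) := by
      rw [hsum]
      exact Finset.sum_congr rfl fun k _ => (self_mul_sign _).symm
    -- The sign vector of the weights, at which `F` takes their `ℓ¹` norm, has norm at most `1`.
    rw [h1]
    refine (le_abs_self _).trans ((F.le_opNorm _).trans ?_)
    refine (mul_le_of_le_one_right (norm_nonneg _) ?_).trans hle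
    refine (pi_norm_le_iff_of_nonneg zero_le_one).2 fun k => ?_
    rcases SignType.sign (F (Pi.single k 1)) <;> simp
  · rw [← hsum]
    have h := hF ⟨T φ, φ, rfl⟩
    rw [h]
    change μ φ = μ (T.equivRange.symm (T.equivRange φ))
    rw [LinearIsometryEquiv.symm_apply_apply]

namespace RadonMeasures

variable {X : Type*} [TopologicalSpace X]

@[simp]
theorem integral_dirac (x : X) (φ : C₀(X, ℝ)) : (dirac x).integral φ = φ x := rfl

@[simp]
theorem integral_add (μ ν : RadonMeasures X) (φ : C₀(X, ℝ)) :
    (μ + ν).integral φ = μ.integral φ + ν.integral φ := rfl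

@[simp]
theorem integral_smul (t : ℝ) (μ : RadonMeasures X) (φ : C₀(X, ℝ)) :
    (t • μ).integral φ = t * μ.integral φ := rfl

theorem integral_finsuppSum (c : X →₀ ℝ) (φ : C₀(X, ℝ)) :
    (c.sum fun v t => t • dirac v).integral φ = c.sum fun v t => t * φ v := by
  let I : RadonMeasures X →+ ℝ :=
    { toFun := fun μ => μ.integral φ
      map_zero' := rfl
      map_add' := fun μ ν => integral_add μ ν φ }
  exact map_finsuppSum I c _

theorem norm_dirac_le (x : X) : ‖dirac x‖ ≤ 1 :=
  LinearMap.mkContinuous_norm_le _ zero_le_one _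

theorem norm_finsuppSum_le (c : X →₀ ℝ) :
    ‖c.sum fun v t => t • dirac v‖ ≤ c.sum fun _ t => |t| := by
  refine norm_sum_le_of_le _ fun v _ => ?_
  rw [norm_smul, Real.norm_eq_abs]
  exact mul_le_of_le_one_right (abs_nonneg _) (norm_dirac_le v)

/-- If the norm on a space `E` of functions is controlled by the values on a finite set `s`, then a
measure can be replaced by a discrete one on `s` of no larger norm, without changing the integrals
of functions in `E`. -/
theorem exists_discrete_of_norming (E : Submodule ℝ C₀(X, ℝ)) {s : Set X} (hs : s.Finite)
    (hE : ∀ φ ∈ E, ∀ C : ℝ, 0 ≤ C → (∀ v ∈ s, |φ v| ≤ C) → ‖φ‖ ≤ C) (μ : RadonMeasures X) :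
    ∃ c : X →₀ ℝ, (c.support : Set X) ⊆ s ∧ ‖c.sum fun v t => t • dirac v‖ ≤ ‖μ‖ ∧
      ∀ φ ∈ E, (c.sum fun v t => t • dirac v).integral φ = μ.integral φ := by
  classical
  have := hs.fintype
  let T : E →ₗᵢ[ℝ] (s → ℝ) :=
    { toFun := fun φ v => (φ : C₀(X, ℝ)) v
      map_add' := fun _ _ => rfl
      map_smul' := fun _ _ => rfl
      norm_map' := fun φ => by
        refine le_antisymm ?_ (hE φ φ.2 ‖fun v : s => (φ : C₀(X, ℝ)) v‖ (norm_nonneg _)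
          fun v hv => ?_)
        · refine (pi_norm_le_iff_of_nonneg (norm_nonneg φ)).2 fun v => ?_
          exact (φ : C₀(X, ℝ)).toBCF.norm_coe_le_norm v
        · exact norm_le_pi_norm (fun v : s => (φ : C₀(X, ℝ)) v) ⟨v, hv⟩ }
  let μE : StrongDual ℝ E := μ.toDual.comp E.subtypeL
  obtain ⟨c, hc, hμ⟩ := exists_weights_of_linearIsometry (E := E) T μE
  let c' : X →₀ ℝ :=
    (Finsupp.equivFunOnFinite.symm c).embDomain (Function.Embedding.subtype (· ∈ s))
  have hsum (g : X → ℝ → ℝ) (hg : ∀ v, g v 0 = 0) : c'.sum g = ∑ v : s, g v (c v) := by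
    exact Finsupp.sum_embDomain.trans (Finsupp.sum_fintype _ _ fun v => hg v)
  refine ⟨c', ?_, ?_, fun φ hφ => ?_⟩
  · intro x hx
    rw [Finsupp.support_embDomain] at hx
    obtain ⟨v, -, rfl⟩ := Finset.mem_map.1 (Finset.mem_coe.1 hx)
    exact v.2
  · refine (norm_finsuppSum_le c').trans ?_
    rw [hsum (fun _ t => |t|) fun _ => abs_zero]
    refine hc.trans (ContinuousLinearMap.opNorm_le_bound _ (norm_nonneg μ) fun φ => ?_)
    exact μ.toDual.le_opNorm φ
  · rw [integral_finsuppSum, hsum (fun v t => t * φ v) fun _ => zero_mul _]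
    exact (hμ ⟨φ, hφ⟩).symm

end RadonMeasures

/-! ### The pseudoinverse as a right inverse -/

theorem PseudoinverseData.apply_pinv {X Y : Type*} [NormedAddCommGroup X] [NormedSpace ℝ X]
    [NormedAddCommGroup Y] [NormedSpace ℝ Y] [CompleteSpace X] [CompleteSpace Y] {L : X →L[ℝ] Y}
    (S : PseudoinverseData L) {y : Y} (hy : y ∈ L.range) : L (S.pinv y) = y := by
  have hproj : S.rangeProj y = ⟨y, hy⟩ :=
    Submodule.projectionOntoL_apply_left _ (⟨y, hy⟩ : L.range)
  have h := S.restrictEquiv.apply_symm_apply (S.rangeProj y)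
  exact (congrArg Subtype.val h).trans (congrArg Subtype.val hproj)

/-! ### Piecewise linear functions on polyhedral sets -/

section Polyhedral

variable {d : ℕ} {ι : Type*} {Ω : Set (EuclideanSpace ℝ (Fin d))}
  {P : ι → Set (EuclideanSpace ℝ (Fin d))}

theorem IsPolytope.finite_extremePoints {Q : Set (EuclideanSpace ℝ (Fin d))} (hQ : IsPolytope Q) :
    (Set.extremePoints ℝ Q).Finite := by
  obtain ⟨T, hT, rfl⟩ := hQ
  exact hT.subset extremePoints_convexHull_subset

/-- A polytope lies in every closed convex set that contains its vertices. -/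
theorem IsPolytope.subset_of_extremePoints_subset {Q C : Set (EuclideanSpace ℝ (Fin d))}
    (hQ : IsPolytope Q) (hC : Convex ℝ C) (hC' : IsClosed C)
    (h : Set.extremePoints ℝ Q ⊆ C) : Q ⊆ C := by
  obtain ⟨T, hT, rfl⟩ := hQ
  rw [← closure_convexHull_extremePoints (hT.isCompact_convexHull ℝ) (convex_convexHull ℝ T)]
  exact closure_minimal (convexHull_min h hC) hC'

theorem finite_pieceVertices [Finite ι] (hP : IsPolyhedralSubdivision Ω P) :
    (pieceVertices Ω P).Finite := by
  refine ((Set.finite_iUnion fun j => (hP.isPolytope j).finite_extremePoints).preimage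
    Subtype.val_injective.injOn).subset ?_
  rintro v ⟨j, hj⟩
  exact Set.mem_iUnion.2 ⟨j, hj⟩

/-- Points of `Ω` that approach a point outside `Ω` leave every compact subset of `Ω`. -/
theorem comap_subtypeVal_nhds_le_cocompact {Z : Type*} [TopologicalSpace Z] [T2Space Z]
    {s : Set Z} {v : Z} (hv : v ∉ s) : comap ((↑) : s → Z) (𝓝 v) ≤ cocompact s := by
  intro t ht
  obtain ⟨K, hK, hKt⟩ := mem_cocompact.1 ht
  refine mem_comap.2 ⟨((↑) '' K)ᶜ, ?_, fun x hx => hKt fun hxK => hx ⟨x, hxK, rfl⟩⟩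
  refine (hK.image continuous_subtype_val).isClosed.isOpen_compl.mem_nhds ?_
  rintro ⟨x, -, rfl⟩
  exact hv x.2

/-- If a function vanishing at infinity agrees with a continuous function `g` on a piece, then `g`
vanishes at the limit points of the piece that are missing from the domain. -/
theorem eq_zero_of_mem_closure_of_notMem {Z : Type*} [TopologicalSpace Z] [T2Space Z]
    {s Q : Set Z} (φ : C₀(s, ℝ)) {g : Z → ℝ} (hg : Continuous g)
    (hφ : ∀ x : s, (x : Z) ∈ Q → φ x = g x) {v : Z} (hv : v ∈ closure (Q ∩ s)) (hvs : v ∉ s) :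
    g v = 0 := by
  have : (𝓝[Q ∩ s] v).NeBot := mem_closure_iff_nhdsWithin_neBot.1 hv
  have hne : (comap ((↑) : s → Z) (𝓝[Q ∩ s] v)).NeBot := by
    refine NeBot.comap_of_range_mem this ?_
    rw [Subtype.range_coe]
    exact mem_of_superset self_mem_nhdsWithin Set.inter_subset_right
  have h0 : Tendsto φ (comap ((↑) : s → Z) (𝓝[Q ∩ s] v)) (𝓝 0) :=
    (zero_at_infty φ).mono_left
      ((comap_mono nhdsWithin_le_nhds).trans (comap_subtypeVal_nhds_le_cocompact hvs))
  have h1 : Tendsto (fun x : s => g x) (comap ((↑) : s → Z) (𝓝[Q ∩ s] v)) (𝓝 (g v)) :=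
    (hg.tendsto v).comp (tendsto_comap.mono_right nhdsWithin_le_nhds)
  refine tendsto_nhds_unique (h1.congr' ?_) h0
  filter_upwards [preimage_mem_comap self_mem_nhdsWithin] with x hx
  exact (hφ x hx.1).symm

theorem isPiecewiseLinear_of_mem_span {κ : Type*} {ρ : κ → C₀(Ω, ℝ)}
    (hρ : ∀ i, IsPiecewiseLinear P (ρ i)) {φ : C₀(Ω, ℝ)}
    (hφ : φ ∈ Submodule.span ℝ (Set.range ρ)) : IsPiecewiseLinear P φ := by
  induction hφ using Submodule.span_induction with
  | mem φ h =>
    obtain ⟨i, rfl⟩ := h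
    exact hρ i
  | zero => exact fun j => ⟨0, 0, fun x _ => by simp⟩
  | add φ ψ _ _ h₁ h₂ =>
    intro j
    obtain ⟨α₁, β₁, h₁⟩ := h₁ j
    obtain ⟨α₂, β₂, h₂⟩ := h₂ j
    refine ⟨α₁ + α₂, β₁ + β₂, fun x hx => ?_⟩
    rw [ZeroAtInftyContinuousMap.add_apply, h₁ x hx, h₂ x hx, inner_add_left]
    ring
  | smul t φ _ h =>
    intro j
    obtain ⟨α, β, h⟩ := h j
    refine ⟨t • α, t * β, fun x hx => ?_⟩
    rw [ZeroAtInftyContinuousMap.smul_apply, h x hx, real_inner_smul_left, smul_eq_mul]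
    ring

/-- The norm of a piecewise linear function vanishing at infinity is attained on the vertices in
`Ω`: vertices outside `Ω` do not count, as the affine pieces vanish there. -/
theorem norm_le_of_forall_pieceVertices (hP : IsPolyhedralSubdivision Ω P) {φ : C₀(Ω, ℝ)}
    (hφ : IsPiecewiseLinear P φ) {C : ℝ} (hC : 0 ≤ C)
    (h : ∀ v ∈ pieceVertices Ω P, |φ v| ≤ C) : ‖φ‖ ≤ C := by
  rw [← ZeroAtInftyContinuousMap.norm_toBCF_eq_norm, BoundedContinuousFunction.norm_le hC]
  intro x
  obtain ⟨j, hj⟩ := Set.mem_iUnion.1 (hP.cover x.2)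
  obtain ⟨α, β, hαβ⟩ := hφ j
  let g : EuclideanSpace ℝ (Fin d) → ℝ := fun y => inner ℝ α y + β
  have hg : Continuous g := by fun_prop
  have hconv : Convex ℝ {y | |g y| ≤ C} := by
    have : {y | |g y| ≤ C} = innerSL ℝ α ⁻¹' Set.Icc (-C - β) (C - β) := by
      ext y
      simp only [g, Set.mem_ofPred_eq, Set.mem_preimage, Set.mem_Icc, innerSL_apply_apply, abs_le]
      constructor <;> rintro ⟨_, _⟩ <;> constructor <;> linarith
    rw [this]
    exact (convex_Icc _ _).linear_preimage (innerSL ℝ α).toLinearMap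
  have hsub := (hP.isPolytope j).subset_of_extremePoints_subset hconv
    (isClosed_le hg.abs continuous_const) fun v hv => by
      change |g v| ≤ C
      by_cases hvΩ : v ∈ Ω
      · rw [← show φ ⟨v, hvΩ⟩ = g v from hαβ ⟨v, hvΩ⟩ hv.1]
        exact h ⟨v, hvΩ⟩ ⟨j, hv⟩
      · rw [eq_zero_of_mem_closure_of_notMem φ hg hαβ (hP.subset_closure j hv.1) hvΩ, abs_zero]
        exact hC
  change |φ x| ≤ C
  rw [hαβ x hj]
  exact hsub hj

end Polyhedral

/-! ### Solutions supported on the vertices -/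

theorem mainTheorem4 {d m : ℕ} {ι : Type*} [Finite ι]
    (Ω : Set (EuclideanSpace ℝ (Fin d))) [LocallyCompactSpace Ω]
    {B : Type*} [NormedAddCommGroup B] [NormedSpace ℝ B] [CompleteSpace B]
    (L : B →L[ℝ] RadonMeasures Ω) (S : PseudoinverseData L)
    (a : Fin m → StrongDual ℝ B)
    (ρ : Fin m → C₀(Ω, ℝ))
    (hρ : ∀ i, ∀ μ : RadonMeasures Ω, (a i).comp S.pinv μ = μ.integral (ρ i))
    (f : (Fin m → ℝ) → EReal) (hf_bot : ∀ x, f x ≠ ⊥)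
    (hf_convex : IsConvexFun f) (hf_lsc : LowerSemicontinuous f)
    (hprimal : ∃ u, IsPrimalSolution f a L u)
    (hrange : L.range = ⊤)
    (hdual : ∃ q, IsDualSolution f a L S.pinv q)
    (P : ι → Set (EuclideanSpace ℝ (Fin d))) (hP : IsPolyhedralSubdivision Ω P)
    (hρP : ∀ i, IsPiecewiseLinear P (ρ i)) :
    ∃ (c : Ω →₀ ℝ) (uK : B), (c.support : Set Ω) ⊆ pieceVertices Ω P ∧ uK ∈ L.ker ∧
      IsPrimalSolution f a L
        (c.sum (fun v t => t • S.pinv (RadonMeasures.dirac v)) + uK) := by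
  obtain ⟨u, hu⟩ := hprimal
  have hL (μ : RadonMeasures Ω) : L (S.pinv μ) = μ := S.apply_pinv (hrange ▸ Submodule.mem_top)
  obtain ⟨c, hc, hnorm, hint⟩ := RadonMeasures.exists_discrete_of_norming
    (Submodule.span ℝ (Set.range ρ)) (finite_pieceVertices hP)
    (fun φ hφ C hC h => norm_le_of_forall_pieceVertices hP
      (isPiecewiseLinear_of_mem_span hρP hφ) hC h) (L u)
  set ν : RadonMeasures Ω := c.sum fun v t => t • RadonMeasures.dirac v with hν
  have hpinv : c.sum (fun v t => t • S.pinv (RadonMeasures.dirac v)) = S.pinv ν := by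
    rw [hν, map_finsuppSum]
    simp only [map_smul]
  refine ⟨c, u - S.pinv (L u), hc, ?_, ?_⟩
  · rw [LinearMap.mem_ker]
    change L (u - S.pinv (L u)) = 0
    rw [map_sub, hL, sub_self]
  rw [hpinv]
  have hA : measurement a (S.pinv ν + (u - S.pinv (L u))) = measurement a u := by
    funext i
    change a i (S.pinv ν + (u - S.pinv (L u))) = a i u
    have h1 : a i (S.pinv ν) = ν.integral (ρ i) := hρ i ν
    have h2 : a i (S.pinv (L u)) = (L u).integral (ρ i) := hρ i (L u)
    rw [map_add, map_sub, h1, h2, hint _ (Submodule.subset_span ⟨i, rfl⟩)]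
    ring
  have hLu : L (S.pinv ν + (u - S.pinv (L u))) = ν := by
    rw [map_add, map_sub, hL, hL, sub_self, add_zero]
  intro w hw
  refine le_trans ?_ (show primalObjective f a L u ≤ primalObjective f a L w from hu hw)
  change f (measurement a _) + _ ≤ f (measurement a u) + _
  rw [hA, hLu]
  exact add_le_add_right (EReal.coe_le_coe_iff.2 hnorm) _
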